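/- For an entire function $f$ and a real number $\rho>0$, say that $f$ has an order of growth $\le\rho$ if there are constants $A,B>0$ with $|f(z)|\le Ae^{B|z|^{\rho}}$ for all $z\in\mathbb C$; the order of growth of $f$ is the infimum of all such $\rho>0$ (and $+\infty$ if there are none). Let $\mathcal O$ be the domain of entire functions, let $\mathcal M$, the field of meromorphic functions on $\mathbb C$, be its quotient field, let $\mathcal O_{<1}\subset\mathcal O$ be the domain of entire functions with order of growth $<1$, and let $\mathcal M_{<1}\subset\mathcal M$ be the quotient field of $\mathcal O_{<1}$, that is, the field of meromorphic functions of order $<1$. Theorem 3.3. Let $P_1,\ldots,P_r\in\mathbb C[z]$ be polynomials such that $P_j-P_k$ is non-constant for all $j\ne k$. Let $d_j:=\deg P_j$ and let $f_j:\mathbb C\to\mathbb C^*$, $f_j(z):=e^{P_j(z)}$, for $1\le j\le r$. (1) The functions $f_1,\ldots,f_r$ are linearly independent over $\mathcal M_{<1}$. (2) If $d_j\ge 1$ for all $1\le j\le r$ and $d_1,\ldots,d_r$ are pairwise distinct, then $f_1,\ldots,f_r$ are algebraically independent over $\mathcal M_{<1}$. -/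

import Mathlib

namespace MeroOrder

/-- The algebra of entire functions, inside the algebra of all functions `ℂ → ℂ`. -/
def Entire : Subalgebra ℂ (ℂ → ℂ) where
  carrier := {f | Differentiable ℂ f}
  mul_mem' := fun hf hg => Differentiable.mul hf hg
  add_mem' := fun hf hg => Differentiable.add hf hg
  algebraMap_mem' := fun c => differentiable_const c

/-- The identity theorem: the ring of entire functions has no zero divisors. -/
instance : IsDomain Entire := by
  have h : NoZeroDivisors Entire := by
    refine ⟨fun {f g} hfg => ?_⟩
    have hf : AnalyticOnNhd ℂ f.1 Set.univ := fun z _ => Differentiable.analyticAt f.2 z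
    have hg : AnalyticOnNhd ℂ g.1 Set.univ := fun z _ => Differentiable.analyticAt g.2 z
    have hfg' : ∀ z ∈ (Set.univ : Set ℂ), f.1 z * g.1 z = 0 := fun z _ =>
      congrFun (congrArg Subtype.val hfg) z
    rcases hf.eq_zero_or_eq_zero_of_mul_eq_zero hg hfg' isPreconnected_univ with h | h
    · exact Or.inl (Subtype.ext (funext fun z => h z trivial))
    · exact Or.inr (Subtype.ext (funext fun z => h z trivial))
  exact NoZeroDivisors.to_isDomain _

/-- `f` has an order of growth `≤ ρ`: there are `A, B > 0` with `|f z| ≤ A * exp (B * |z| ^ ρ)`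
for all `z`. -/
def HasGrowthLE (f : ℂ → ℂ) (ρ : ℝ) : Prop :=
  ∃ A B : ℝ, 0 < A ∧ 0 < B ∧ ∀ z : ℂ, ‖f z‖ ≤ A * Real.exp (B * ‖z‖ ^ ρ)

/-- The order of growth of `f`: the infimum of all real `ρ > 0` such that `f` has an order of
growth `≤ ρ`. It is `∞` if there is no such `ρ`. -/
noncomputable def growthOrder (f : ℂ → ℂ) : ENNReal :=
  ⨅ (ρ : ℝ) (_ : 0 < ρ) (_ : HasGrowthLE f ρ), ENNReal.ofReal ρ

theorem HasGrowthLE.mono {f : ℂ → ℂ} {ρ σ : ℝ} (hρ : 0 < ρ) (h : ρ ≤ σ)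
    (hf : HasGrowthLE f ρ) : HasGrowthLE f σ := by
  obtain ⟨A, B, hA, hB, hf⟩ := hf
  refine ⟨A * Real.exp B, B, by positivity, hB, fun z => (hf z).trans ?_⟩
  rw [mul_assoc, ← Real.exp_add]
  have key : ‖z‖ ^ ρ ≤ 1 + ‖z‖ ^ σ := by
    rcases le_total ‖z‖ 1 with hz | hz
    · have h1 := Real.rpow_le_one (norm_nonneg z) hz hρ.le
      have h2 := Real.rpow_nonneg (norm_nonneg z) σ
      linarith
    · have h1 := Real.rpow_le_rpow_of_exponent_le hz h
      linarith
  have : B * ‖z‖ ^ ρ ≤ B + B * ‖z‖ ^ σ := by nlinarith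
  gcongr

theorem HasGrowthLE.add {f g : ℂ → ℂ} {ρ : ℝ} (hf : HasGrowthLE f ρ) (hg : HasGrowthLE g ρ) :
    HasGrowthLE (f + g) ρ := by
  obtain ⟨A, B, hA, hB, hf⟩ := hf
  obtain ⟨A', B', hA', hB', hg⟩ := hg
  refine ⟨A + A', B + B', by positivity, by positivity, fun z => (norm_add_le _ _).trans ?_⟩
  have hz := Real.rpow_nonneg (norm_nonneg z) ρ
  rw [add_mul]
  refine add_le_add ((hf z).trans ?_) ((hg z).trans ?_) <;> gcongr <;> linarith

theorem HasGrowthLE.mul {f g : ℂ → ℂ} {ρ : ℝ} (hf : HasGrowthLE f ρ) (hg : HasGrowthLE g ρ) :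
    HasGrowthLE (f * g) ρ := by
  obtain ⟨A, B, hA, hB, hf⟩ := hf
  obtain ⟨A', B', hA', hB', hg⟩ := hg
  refine ⟨A * A', B + B', by positivity, by positivity, fun z => ?_⟩
  rw [Pi.mul_apply, norm_mul, add_mul, Real.exp_add]
  calc ‖f z‖ * ‖g z‖ ≤ (A * Real.exp (B * ‖z‖ ^ ρ)) * (A' * Real.exp (B' * ‖z‖ ^ ρ)) :=
        mul_le_mul (hf z) (hg z) (norm_nonneg _) (by positivity)
    _ = _ := by ring

theorem hasGrowthLE_const (c : ℂ) (ρ : ℝ) : HasGrowthLE (fun _ => c) ρ := by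
  refine ⟨‖c‖ + 1, 1, by positivity, one_pos, fun z => ?_⟩
  have h1 : 1 ≤ Real.exp (1 * ‖z‖ ^ ρ) :=
    Real.one_le_exp (mul_nonneg zero_le_one (Real.rpow_nonneg (norm_nonneg z) ρ))
  have h2 := norm_nonneg c
  nlinarith

theorem growthOrder_lt_iff {f : ℂ → ℂ} {ρ : ℝ} :
    growthOrder f < ENNReal.ofReal ρ ↔ ∃ σ : ℝ, 0 < σ ∧ σ < ρ ∧ HasGrowthLE f σ := by
  simp only [growthOrder, iInf_lt_iff, exists_prop]
  constructor
  · rintro ⟨σ, h0, hf, h⟩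
    exact ⟨σ, h0, (ENNReal.ofReal_lt_ofReal_iff_of_nonneg h0.le).1 h, hf⟩
  · rintro ⟨σ, h0, h, hf⟩
    exact ⟨σ, h0, hf, (ENNReal.ofReal_lt_ofReal_iff_of_nonneg h0.le).2 h⟩

theorem growthOrder_add_lt {f g : ℂ → ℂ} {ρ : ℝ} (hf : growthOrder f < ENNReal.ofReal ρ)
    (hg : growthOrder g < ENNReal.ofReal ρ) : growthOrder (f + g) < ENNReal.ofReal ρ := by
  obtain ⟨σ, h0, h1, hf⟩ := growthOrder_lt_iff.1 hf
  obtain ⟨τ, k0, k1, hg⟩ := growthOrder_lt_iff.1 hg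
  exact growthOrder_lt_iff.2 ⟨max σ τ, lt_max_of_lt_left h0, max_lt h1 k1,
    (hf.mono h0 (le_max_left _ _)).add (hg.mono k0 (le_max_right _ _))⟩

theorem growthOrder_mul_lt {f g : ℂ → ℂ} {ρ : ℝ} (hf : growthOrder f < ENNReal.ofReal ρ)
    (hg : growthOrder g < ENNReal.ofReal ρ) : growthOrder (f * g) < ENNReal.ofReal ρ := by
  obtain ⟨σ, h0, h1, hf⟩ := growthOrder_lt_iff.1 hf
  obtain ⟨τ, k0, k1, hg⟩ := growthOrder_lt_iff.1 hg
  exact growthOrder_lt_iff.2 ⟨max σ τ, lt_max_of_lt_left h0, max_lt h1 k1,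
    (hf.mono h0 (le_max_left _ _)).mul (hg.mono k0 (le_max_right _ _))⟩

theorem growthOrder_const_lt (c : ℂ) {ρ : ℝ} (hρ : 0 < ρ) :
    growthOrder (fun _ => c) < ENNReal.ofReal ρ :=
  growthOrder_lt_iff.2 ⟨ρ / 2, by linarith, by linarith, hasGrowthLE_const c _⟩

/-- The domain `𝓞_{<ρ}` of entire functions with order of growth `< ρ`, for a real `ρ > 0`. -/
def EntireLT (ρ : ℝ) (hρ : 0 < ρ) : Subalgebra ℂ Entire where
  carrier := {f | growthOrder (f : ℂ → ℂ) < ENNReal.ofReal ρ}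
  mul_mem' := fun hf hg => growthOrder_mul_lt hf hg
  add_mem' := fun hf hg => growthOrder_add_lt hf hg
  algebraMap_mem' := fun c => growthOrder_const_lt c hρ

/-- The field `𝓜` of meromorphic functions on `ℂ`, as the quotient field of the ring of entire
functions. -/
abbrev Mero : Type := FractionRing Entire

/-- The field `𝓜_{<ρ}` of meromorphic functions of order `< ρ`, that is, the quotient field of
`𝓞_{<ρ}`, realized inside `𝓜` as the set of all `g / h` with `g, h ∈ 𝓞_{<ρ}` and `h ≠ 0`. -/
def MeroLT (ρ : ℝ) (hρ : 0 < ρ) : Subfield Mero where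
  carrier := {x | ∃ g ∈ EntireLT ρ hρ, ∃ h ∈ EntireLT ρ hρ, h ≠ 0 ∧
    x = algebraMap Entire Mero g / algebraMap Entire Mero h}
  mul_mem' := by
    rintro _ _ ⟨g, hg, h, hh, h0, rfl⟩ ⟨g', hg', h', hh', h0', rfl⟩
    exact ⟨g * g', mul_mem hg hg', h * h', mul_mem hh hh', mul_ne_zero h0 h0', by
      rw [map_mul, map_mul, div_mul_div_comm]⟩
  one_mem' := ⟨1, one_mem _, 1, one_mem _, one_ne_zero, by simp⟩
  add_mem' := by
    rintro _ _ ⟨g, hg, h, hh, h0, rfl⟩ ⟨g', hg', h', hh', h0', rfl⟩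
    have i : Function.Injective (algebraMap Entire Mero) := IsFractionRing.injective Entire Mero
    refine ⟨g * h' + h * g', add_mem (mul_mem hg hh') (mul_mem hh hg'), h * h', mul_mem hh hh',
      mul_ne_zero h0 h0', ?_⟩
    rw [map_add, map_mul, map_mul, map_mul]
    exact div_add_div _ _ ((map_ne_zero_iff _ i).2 h0) ((map_ne_zero_iff _ i).2 h0')
  zero_mem' := ⟨0, zero_mem _, 1, one_mem _, one_ne_zero, by simp⟩
  neg_mem' := by
    rintro _ ⟨g, hg, h, hh, h0, rfl⟩
    exact ⟨-g, neg_mem hg, h, hh, h0, by rw [map_neg, neg_div]⟩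
  inv_mem' := by
    rintro _ ⟨g, hg, h, hh, h0, rfl⟩
    by_cases hg0 : g = 0
    · exact ⟨0, zero_mem _, 1, one_mem _, one_ne_zero, by simp [hg0]⟩
    · exact ⟨h, hh, g, hg, hg0, by rw [inv_div]⟩

/-- The entire function `z ↦ exp (P z)`. -/
noncomputable def expPoly (P : Polynomial ℂ) : Entire :=
  ⟨fun z => Complex.exp (P.eval z), P.differentiable.cexp⟩

end MeroOrder

/-! Clear denominators in a linear relation to get ∑ g_j e^{P_j} = 0 with g_j of order < 1.
Differentiating gives a second relation with coefficients g_j' + g_j P_j', again of order < 1;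
eliminating one term and inducting makes Wronskians of pairs of terms vanish. Two such terms are
proportional (`exists_eq_smul_of_wronskian_eq_zero`), so h = g e^Q with Q non-constant and g, h of
order < 1. Growth excludes this (`natDegree_eq_zero_of_eq_mul_exp`): by Jensen the mean of |log |g||
on |z| = r is O(r^σ) with σ < 1, and likewise for h, while the mean of |Re Q| grows at least
linearly. Algebraic independence is linear independence of the monomials, which are again
exponentials of polynomials. -/

/-! ### Means over circles and growth. -/

open Real MeromorphicOn Metric Set Filter Topology in
/-- A consequence of Jensen's formula: the mean of `|log ‖f‖|` over a circle is controlled by an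
upper bound for `‖f‖`. -/
theorem circleAverage_abs_log_norm_le {f : ℂ → ℂ} (hf : Differentiable ℂ f) {r M : ℝ} (hr : 1 ≤ r)
    (hM : 0 ≤ M) (hfM : ∀ z ∈ sphere (0 : ℂ) r, ‖f z‖ ≤ exp M) :
    circleAverage (fun z => |log ‖f z‖|) 0 r
      ≤ 2 * M - log ‖meromorphicTrailingCoeffAt f 0‖ := by
  have hfa : AnalyticOnNhd ℂ f univ := fun z _ => hf.analyticAt z
  have hmer : Meromorphic f := fun z => (hf.analyticAt z).meromorphicAt
  have hint : CircleIntegrable (fun z => log ‖f z‖) 0 r :=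
    MeromorphicOn.circleIntegrable_log_norm fun z _ => hmer z
  have hJ := Function.locallyFinsuppWithin.logCounting_divisor_eq_circleAverage_sub_const hmer
    (by positivity : r ≠ 0)
  have hN := Function.locallyFinsuppWithin.logCounting_nonneg hfa.divisor_nonneg hr
  -- Jensen bounds the mean of `log ‖f z‖` below, as `f` has no poles. It remains to use |t| ≤ 2M -
  -- t for t ≤ M, 0 ≤ M.
  have hle : circleAverage (fun z => |log ‖f z‖|) 0 r
      ≤ circleAverage (fun z => 2 * M - log ‖f z‖) 0 r := by
    refine circleAverage_mono hint.abs ((circleIntegrable_const _ _ _).sub hint) fun z hz => ?_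
    rw [abs_of_pos (by positivity)] at hz
    have h1 : log ‖f z‖ ≤ M := by
      rcases (norm_nonneg (f z)).eq_or_lt with h0 | h0
      · rw [← h0, log_zero]; exact hM
      · exact (log_le_iff_le_exp h0).2 (hfM z hz)
    rcases abs_cases (log ‖f z‖) with h | h <;> linarith
  rw [circleAverage_fun_sub (circleIntegrable_const _ _ _) hint, circleAverage_const] at hle
  linarith

open Real Metric Polynomial ComplexConjugate in
/-- The real part of a polynomial of positive degree is large in the mean on large circles. -/
theorem Polynomial.norm_leadingCoeff_mul_pow_le_circleAverage (Q : Polynomial ℂ)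
    (hQ : 1 ≤ Q.natDegree) {r : ℝ} (hr : 0 < r) :
    ‖Q.leadingCoeff‖ * r ^ Q.natDegree ≤ 2 * circleAverage (fun z => |(Q.eval z).re|) 0 r := by
  set d := Q.natDegree with hd
  -- On |z| = r, conj z = r²/z turns (Q + conj Q) z^d into this polynomial in z, to which the mean
  -- value property applies. At 0 only the term k = d survives.
  set E : ℂ → ℂ := fun z => Q.eval z * z ^ d +
    ∑ k ∈ Finset.range (d + 1), conj (Q.coeff k) * (r : ℂ) ^ (2 * k) * z ^ (d - k) with hE
  have hEd : Differentiable ℂ E := by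
    have := Q.differentiable
    fun_prop
  have hE0 : E 0 = conj Q.leadingCoeff * (r : ℂ) ^ (2 * d) := by
    have h0 : (0 : ℂ) ^ d = 0 := zero_pow (by omega)
    simp only [hE, h0, mul_zero, zero_add]
    rw [Finset.sum_range_succ, Finset.sum_eq_zero]
    · rw [Nat.sub_self, pow_zero, mul_one, zero_add, hd, Polynomial.coeff_natDegree]
    · intro k hk
      rw [Finset.mem_range] at hk
      rw [zero_pow (by omega), mul_zero]
  have hEs : ∀ z ∈ sphere (0 : ℂ) r, E z = (2 * (Q.eval z).re : ℝ) * z ^ d := by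
    intro z hz
    have hzr : z * conj z = (r : ℂ) ^ 2 := by
      rw [Complex.mul_conj, Complex.normSq_eq_norm_sq, mem_sphere_zero_iff_norm.1 hz]
      push_cast; rfl
    have hconj : conj (Q.eval z) * z ^ d = ∑ k ∈ Finset.range (d + 1),
        conj (Q.coeff k) * (r : ℂ) ^ (2 * k) * z ^ (d - k) := by
      rw [Polynomial.eval_eq_sum_range, map_sum, Finset.sum_mul]
      refine Finset.sum_congr rfl fun k hk => ?_
      have hk : k ≤ d := by rw [Finset.mem_range] at hk; omega
      rw [map_mul, map_pow, pow_mul, ← hzr, mul_pow]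
      nth_rw 1 [← Nat.sub_add_cancel hk]
      rw [pow_add]
      ring
    have h2 : ((2 * (Q.eval z).re : ℝ) : ℂ) = Q.eval z + conj (Q.eval z) := by
      rw [Complex.add_conj]
    rw [h2, add_mul, hconj]
  have hmean : circleAverage E 0 r = E 0 := hEd.diffContOnCl.circleAverage
  have hnorm : ‖circleAverage E 0 r‖ ≤ circleAverage (fun z => ‖E z‖) 0 r := by
    simp only [circleAverage, norm_smul, smul_eq_mul]
    rw [Real.norm_of_nonneg (by positivity)]
    gcongr
    exact intervalIntegral.norm_integral_le_integral_norm (by positivity)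
  have hval : circleAverage (fun z => ‖E z‖) 0 r
      = (2 * r ^ d) * circleAverage (fun z => |(Q.eval z).re|) 0 r := by
    rw [← smul_eq_mul, ← circleAverage_fun_smul]
    refine circleAverage_congr_sphere fun z hz => ?_
    rw [abs_of_pos hr] at hz
    simp only [hEs z hz, norm_mul, norm_pow, mem_sphere_zero_iff_norm.1 hz, Complex.norm_real,
      norm_eq_abs, smul_eq_mul, abs_two]
    ring
  rw [hmean, hval, hE0, norm_mul, RCLike.norm_conj, norm_pow, Complex.norm_real, norm_eq_abs,
    abs_of_pos hr, two_mul d, pow_add] at hnorm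
  have hp : 0 < r ^ d := by positivity
  nlinarith [hnorm, hp]

namespace MeroOrder

open Real Filter Asymptotics Metric

theorem HasGrowthLE.exists_circleAverage_abs_log_norm_le {f : ℂ → ℂ} {σ : ℝ}
    (hf : Differentiable ℂ f) (hg : HasGrowthLE f σ) :
    ∃ C B : ℝ, ∀ r : ℝ, 1 ≤ r → circleAverage (fun z => |log ‖f z‖|) 0 r ≤ C + B * r ^ σ := by
  obtain ⟨A, B, hA, hB, hg⟩ := hg
  refine ⟨2 * |log A| - log ‖meromorphicTrailingCoeffAt f 0‖, 2 * B, fun r hr => ?_⟩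
  have h0 : 0 ≤ r ^ σ := rpow_nonneg (by linarith) σ
  refine (circleAverage_abs_log_norm_le hf hr (M := |log A| + B * r ^ σ) (by positivity)
    fun z hz => ?_).trans (by linarith)
  refine (hg z).trans ?_
  rw [mem_sphere_zero_iff_norm.1 hz, exp_add]
  gcongr
  calc A = exp (log A) := (exp_log hA).symm
    _ ≤ _ := exp_le_exp.2 (le_abs_self _)

/-- Two nonzero entire functions of order `< 1` cannot differ by a factor `exp Q` with `Q` a
non-constant polynomial. -/
theorem natDegree_eq_zero_of_eq_mul_exp {g h : ℂ → ℂ} {Q : Polynomial ℂ}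
    (hg : Differentiable ℂ g) (hh : Differentiable ℂ h)
    (hgo : growthOrder g < ENNReal.ofReal 1) (hho : growthOrder h < ENNReal.ofReal 1)
    (hg0 : g ≠ 0) (hgh : ∀ z, h z = g z * Complex.exp (Q.eval z)) : Q.natDegree = 0 := by
  by_contra hQ
  obtain ⟨σ, hσ0, hσ1, hgo⟩ := growthOrder_lt_iff.1 hgo
  obtain ⟨τ, hτ0, hτ1, hho⟩ := growthOrder_lt_iff.1 hho
  obtain ⟨C, B, hC⟩ := hgo.exists_circleAverage_abs_log_norm_le hg
  obtain ⟨C', B', hC'⟩ := hho.exists_circleAverage_abs_log_norm_le hh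
  obtain ⟨x, hx⟩ := Function.ne_iff.1 hg0
  have hcod := AnalyticOnNhd.preimage_zero_mem_codiscrete
    (fun z _ => hg.analyticAt z : AnalyticOnNhd ℂ g Set.univ) hx
  have hgi (r : ℝ) : CircleIntegrable (fun z => log ‖g z‖) 0 r :=
    MeromorphicOn.circleIntegrable_log_norm fun z _ => (hg.analyticAt z).meromorphicAt
  have hhi (r : ℝ) : CircleIntegrable (fun z => log ‖h z‖) 0 r :=
    MeromorphicOn.circleIntegrable_log_norm fun z _ => (hh.analyticAt z).meromorphicAt
  have hbound : ∀ r : ℝ, 1 ≤ r →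
      ‖Q.leadingCoeff‖ * r ≤ 2 * ((C + C') * 1 + (B * r ^ σ + B' * r ^ τ)) := by
    intro r hr
    have hr0 : 0 < r := by linarith
    -- log |h| - log |g| = Re Q may fail at zeros of g, where `log 0 = 0`; these are discrete and do
    -- not affect the mean.
    have h1 : circleAverage (fun z => |(Q.eval z).re|) 0 r
        = circleAverage (fun z => |log ‖h z‖ - log ‖g z‖|) 0 r := by
      refine circleAverage_congr_codiscreteWithin ?_ hr0.ne'
      refine Filter.codiscreteWithin_mono (Set.subset_univ _) ?_
      filter_upwards [hcod] with z hz
      have hz : ‖g z‖ ≠ 0 := norm_ne_zero_iff.2 hz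
      rw [hgh, norm_mul, log_mul hz (norm_ne_zero_iff.2 (Complex.exp_ne_zero _)),
        Complex.norm_exp, log_exp, add_sub_cancel_left]
    have h2 : circleAverage (fun z => |log ‖h z‖ - log ‖g z‖|) 0 r
        ≤ circleAverage (fun z => |log ‖h z‖| + |log ‖g z‖|) 0 r :=
      circleAverage_mono ((hhi r).sub (hgi r)).abs ((hhi r).abs.add (hgi r).abs)
        fun z _ => abs_sub _ _
    have h2' : circleAverage (fun z => |log ‖h z‖| + |log ‖g z‖|) 0 r = _ :=
      circleAverage_fun_add (hhi r).abs (hgi r).abs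
    rw [h2'] at h2
    have h3 := Q.norm_leadingCoeff_mul_pow_le_circleAverage (Nat.one_le_iff_ne_zero.2 hQ) hr0
    have h4 : ‖Q.leadingCoeff‖ * r ≤ ‖Q.leadingCoeff‖ * r ^ Q.natDegree := by
      gcongr
      exact le_self_pow₀ hr hQ
    linarith [hC r hr, hC' r hr]
  have hrpow {s : ℝ} (hs : s < 1) : (fun r : ℝ => r ^ s) =o[atTop] fun r : ℝ => r := by
    refine isLittleO_of_tendsto' ?_ ?_
    · filter_upwards [eventually_gt_atTop 0] with r hr h0
      exact absurd h0 hr.ne'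
    · refine (tendsto_rpow_neg_atTop (sub_pos.2 hs)).congr' ?_
      filter_upwards [eventually_gt_atTop 0] with r hr
      rw [neg_sub, rpow_sub hr, rpow_one]
  have ho : (fun r : ℝ => 2 * ((C + C') * 1 + (B * r ^ σ + B' * r ^ τ)))
      =o[atTop] fun r : ℝ => r :=
    (((isLittleO_const_id_atTop (1 : ℝ)).const_mul_left _).add
      (((hrpow hσ1).const_mul_left _).add ((hrpow hτ1).const_mul_left _))).const_mul_left _
  have hlead : 0 < ‖Q.leadingCoeff‖ := norm_pos_iff.2 <| by
    rw [Polynomial.leadingCoeff_ne_zero]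
    rintro rfl
    exact hQ Polynomial.natDegree_zero
  obtain ⟨r, hr, hr1⟩ := ((ho.def (half_pos hlead)).and (eventually_ge_atTop 1)).exists
  have h5 := hbound r hr1
  rw [norm_eq_abs, norm_eq_abs, abs_of_pos (by linarith : 0 < r)] at hr
  have h6 := (le_abs_self _).trans hr
  nlinarith

end MeroOrder

namespace MeroOrder

/-! ### Derivatives and exponentials of polynomials. -/

/-- Cauchy's estimate on the unit circle about z; ρ ≤ 1 makes t ↦ t^ρ subadditive, so the shift by 1
costs only a factor e^B. -/
theorem HasGrowthLE.deriv {f : ℂ → ℂ} {ρ : ℝ} (hf : Differentiable ℂ f) (h0 : 0 ≤ ρ) (h1 : ρ ≤ 1)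
    (hg : HasGrowthLE f ρ) : HasGrowthLE (deriv f) ρ := by
  obtain ⟨A, B, hA, hB, hg⟩ := hg
  refine ⟨A * Real.exp B, B, by positivity, hB, fun z => ?_⟩
  have h := Complex.norm_deriv_le_of_forall_mem_sphere_norm_le (c := z) one_pos hf.diffContOnCl
    (C := A * Real.exp (B * (‖z‖ ^ ρ + 1))) fun w hw => (hg w).trans ?_
  · rw [div_one, mul_add, mul_one, add_comm, Real.exp_add, ← mul_assoc] at h
    exact h
  · have hw : ‖w‖ ≤ ‖z‖ + 1 := by
      rw [mem_sphere_iff_norm] at hw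
      linarith [norm_le_norm_add_norm_sub' w z]
    have h2 : ‖w‖ ^ ρ ≤ ‖z‖ ^ ρ + 1 := by
      calc ‖w‖ ^ ρ ≤ (‖z‖ + 1) ^ ρ := by gcongr
        _ ≤ ‖z‖ ^ ρ + 1 ^ ρ := Real.rpow_add_le_add_rpow (norm_nonneg z) zero_le_one h0 h1
        _ = ‖z‖ ^ ρ + 1 := by rw [Real.one_rpow]
    gcongr

/-- Differentiation of entire functions. -/
noncomputable def Entire.derivation : Derivation ℂ Entire Entire :=
  Derivation.mk'
    { toFun := fun f =>
        ⟨deriv f.1, fun z => (Differentiable.analyticAt f.2 z).deriv.differentiableAt⟩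
      map_add' := fun f g => Subtype.ext <| funext fun z => deriv_add (f.2 z) (g.2 z)
      map_smul' := fun c f => Subtype.ext <| funext fun z => deriv_const_smul c (f.2 z) }
    fun f g => Subtype.ext <| funext fun z => by
      refine (deriv_mul (f.2 z) (g.2 z)).trans ?_
      change _ = f.1 z * deriv g.1 z + g.1 z * deriv f.1 z
      ring

theorem derivation_mem_entireLT {f : Entire} (hf : f ∈ EntireLT 1 one_pos) :
    Entire.derivation f ∈ EntireLT 1 one_pos := by
  obtain ⟨σ, h0, h1, hf'⟩ := growthOrder_lt_iff.1 hf
  exact growthOrder_lt_iff.2 ⟨σ, h0, h1, hf'.deriv f.2 h0.le h1.le⟩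

/-- The identity function as an entire function. -/
def Entire.id : Entire := ⟨fun z => z, differentiable_id⟩

theorem id_mem_entireLT : Entire.id ∈ EntireLT 1 one_pos := by
  -- With t = |z|^(1/2), 1 + t + t²/2 ≤ e^t gives |z| = t² ≤ 2e^t.
  refine growthOrder_lt_iff.2 ⟨1 / 2, by norm_num, by norm_num, 2, 1, two_pos, one_pos, fun z => ?_⟩
  change ‖z‖ ≤ _
  have h0 := Real.rpow_nonneg (norm_nonneg z) (1 / 2)
  have h1 := Real.quadratic_le_exp_of_nonneg h0
  have h2 : (‖z‖ ^ (1 / 2 : ℝ)) ^ 2 = ‖z‖ := by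
    rw [← Real.sqrt_eq_rpow, Real.sq_sqrt (norm_nonneg z)]
  rw [one_mul]
  linarith

theorem aeval_id_apply (P : Polynomial ℂ) (z : ℂ) :
    (Polynomial.aeval Entire.id P).1 z = P.eval z := by
  have h := Polynomial.aeval_algHom_apply ((Pi.evalAlgHom ℂ (fun _ : ℂ => ℂ) z).comp Entire.val)
    Entire.id P
  rw [← Polynomial.coe_aeval_eq_eval]
  exact h.symm

theorem aeval_id_mem_entireLT (P : Polynomial ℂ) :
    Polynomial.aeval Entire.id P ∈ EntireLT 1 one_pos :=
  Algebra.adjoin_le (Set.singleton_subset_iff.2 id_mem_entireLT)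
    (Polynomial.aeval_mem_adjoin_singleton ℂ Entire.id)

theorem derivation_expPoly (P : Polynomial ℂ) :
    Entire.derivation (expPoly P) = Polynomial.aeval Entire.id P.derivative * expPoly P := by
  refine Subtype.ext <| funext fun z => ?_
  change deriv (fun z => Complex.exp (P.eval z)) z
    = (Polynomial.aeval Entire.id P.derivative).1 z * Complex.exp (P.eval z)
  rw [aeval_id_apply, (P.hasDerivAt z).cexp.deriv, mul_comm]

theorem expPoly_ne_zero (P : Polynomial ℂ) : expPoly P ≠ 0 := fun h =>
  Complex.exp_ne_zero (P.eval 0) (congrFun (congrArg Subtype.val h) 0)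

theorem expPoly_add (P Q : Polynomial ℂ) : expPoly (P + Q) = expPoly P * expPoly Q :=
  Subtype.ext <| funext fun z => by
    change Complex.exp ((P + Q).eval z) = Complex.exp (P.eval z) * Complex.exp (Q.eval z)
    rw [Polynomial.eval_add, Complex.exp_add]

theorem expPoly_zero : expPoly 0 = 1 :=
  Subtype.ext <| funext fun z => by
    change Complex.exp ((0 : Polynomial ℂ).eval z) = 1
    rw [Polynomial.eval_zero, Complex.exp_zero]

/-! ### Wronskians and linear independence. -/

/-- Two entire functions with vanishing Wronskian are proportional. -/
theorem exists_eq_smul_of_wronskian_eq_zero {F G : Entire} (hG : G ≠ 0)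
    (h : Entire.derivation F * G = F * Entire.derivation G) : ∃ c : ℂ, F = c • G := by
  obtain ⟨x, hx⟩ : ∃ x, G.1 x ≠ 0 := Function.ne_iff.1 fun h0 => hG (Subtype.ext h0)
  obtain ⟨ε, hε, hball⟩ := Metric.eventually_nhds_iff_ball.1
    ((Differentiable.continuous G.2).continuousAt.eventually_ne hx)
  have hd : ∀ z ∈ Metric.ball x ε, HasDerivAt (fun z => F.1 z / G.1 z) 0 z := fun z hz => by
    have h1 := (F.2 z).hasDerivAt.div (G.2 z).hasDerivAt (hball z hz)
    have h2 : deriv F.1 z * G.1 z = F.1 z * deriv G.1 z := congrFun (congrArg Subtype.val h) z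
    rwa [h2, sub_self, zero_div] at h1
  have hconst : ∀ z ∈ Metric.ball x ε, F.1 z / G.1 z = F.1 x / G.1 x := fun z hz =>
    Metric.isOpen_ball.is_const_of_deriv_eq_zero (convex_ball x ε).isPreconnected
      (fun w hw => (hd w hw).differentiableAt.differentiableWithinAt)
      (fun w hw => (hd w hw).deriv) hz (Metric.mem_ball_self hε)
  refine ⟨F.1 x / G.1 x, Subtype.ext ?_⟩
  -- F/G is constant only on a ball free of zeros of G; the identity theorem gives F = cG
  -- everywhere.
  refine AnalyticOnNhd.eq_of_eventuallyEq (z₀ := x) (fun z _ => Differentiable.analyticAt F.2 z)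
    (fun z _ => Differentiable.analyticAt ((F.1 x / G.1 x) • G).2 z) ?_
  filter_upwards [Metric.ball_mem_nhds x hε] with z hz
  change F.1 z = F.1 x / G.1 x * G.1 z
  rw [← hconst z hz, div_mul_cancel₀ _ (hball z hz)]

/-- Linear independence of two exponentials, for proportional products. -/
theorem eq_zero_of_mul_expPoly_eq_smul {g h : Entire} {P Q : Polynomial ℂ}
    (hg : g ∈ EntireLT 1 one_pos) (hh : h ∈ EntireLT 1 one_pos)
    (hPQ : (P - Q).natDegree ≠ 0) {c : ℂ} (hc : g * expPoly P = c • (h * expPoly Q)) :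
    g = 0 := by
  by_contra hg0
  refine hPQ (natDegree_eq_zero_of_eq_mul_exp g.2 (c • h).2 hg
    ((EntireLT 1 one_pos).smul_mem hh c) (fun h0 => hg0 (Subtype.ext h0)) fun z => ?_)
  have hz : g.1 z * Complex.exp (P.eval z) = c * (h.1 z * Complex.exp (Q.eval z)) :=
    congrFun (congrArg Subtype.val hc) z
  change c * h.1 z = g.1 z * _
  rw [Polynomial.eval_sub, Complex.exp_sub, mul_div_assoc', hz,
    eq_div_iff (Complex.exp_ne_zero _), mul_assoc]

theorem eq_zero_of_sum_mul_expPoly_eq_zero {ι : Type*} (P : ι → Polynomial ℂ)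
    (hP : ∀ j k, j ≠ k → (P j - P k).natDegree ≠ 0) (s : Finset ι) (g : ι → Entire)
    (hg : ∀ j ∈ s, g j ∈ EntireLT 1 one_pos) (hsum : ∑ j ∈ s, g j * expPoly (P j) = 0) :
    ∀ j ∈ s, g j = 0 := by
  classical
  induction s using Finset.induction_on generalizing g with
  | empty => simp
  | insert a s ha ih =>
    rw [Finset.forall_mem_insert] at hg ⊢
    obtain ⟨hga, hg⟩ := hg
    rw [Finset.sum_insert ha] at hsum
    by_cases h0 : g a = 0
    · rw [h0, zero_mul, zero_add] at hsum
      exact ⟨h0, ih g hg hsum⟩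
    exfalso
    -- `u j * expPoly (P j)` is the derivative of `g j * expPoly (P j)`
    let u : ι → Entire := fun j =>
      Entire.derivation (g j) + g j * Polynomial.aeval Entire.id (P j).derivative
    have hD (j : ι) : Entire.derivation (g j * expPoly (P j)) = u j * expPoly (P j) := by
      rw [Derivation.leibniz, derivation_expPoly, smul_eq_mul, smul_eq_mul]
      ring
    have hu {j : ι} (hj : g j ∈ EntireLT 1 one_pos) : u j ∈ EntireLT 1 one_pos :=
      add_mem (derivation_mem_entireLT hj) (mul_mem hj (aeval_id_mem_entireLT _))
    have hsum' : u a * expPoly (P a) + ∑ j ∈ s, u j * expPoly (P j) = 0 := by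
      have := congrArg Entire.derivation hsum
      simpa only [map_add, map_sum, map_zero, hD] using this
    -- The term of index `a` cancels in `u a * hsum - g a * hsum'`, leaving a relation over `s`.
    have hw := ih (fun j => u a * g j - g a * u j)
      (fun j hj => sub_mem (mul_mem (hu hga) (hg j hj)) (mul_mem hga (hu (hg j hj)))) <| by
        simp only [sub_mul, mul_assoc, Finset.sum_sub_distrib, ← Finset.mul_sum]
        linear_combination u a * hsum - g a * hsum'
    -- `hw` says that the Wronskian of the terms `a` and `j` vanishes; proportionality would then
    -- force `g a = 0`.
    have hs : ∀ j ∈ s, g j = 0 := fun j hj => by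
      by_contra hj0
      obtain ⟨c, hc⟩ := exists_eq_smul_of_wronskian_eq_zero
        (F := g a * expPoly (P a)) (mul_ne_zero hj0 (expPoly_ne_zero (P j))) (by
          rw [hD, hD]
          linear_combination expPoly (P a) * expPoly (P j) * hw j hj)
      exact h0 (eq_zero_of_mul_expPoly_eq_smul hga (hg j hj)
        (hP a j fun h => ha (h ▸ hj)) hc)
    rw [Finset.sum_eq_zero fun j hj => by rw [hs j hj, zero_mul], add_zero] at hsum
    exact mul_ne_zero h0 (expPoly_ne_zero _) hsum

/-- Infinite index types are allowed so that this applies to the family of all monomials. -/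
theorem linearIndependent_expPoly {ι : Type*} (P : ι → Polynomial ℂ)
    (hP : ∀ j k, j ≠ k → (P j - P k).natDegree ≠ 0) :
    LinearIndependent (MeroLT 1 one_pos) fun j => algebraMap Entire Mero (expPoly (P j)) := by
  classical
  rw [linearIndependent_iff']
  intro s c hsum
  choose g hg h hh h0 hc using fun j => (c j).2
  have hinj : Function.Injective (algebraMap Entire Mero) := IsFractionRing.injective Entire Mero
  have hne (j : ι) : algebraMap Entire Mero (h j) ≠ 0 := (map_ne_zero_iff _ hinj).2 (h0 j)
  -- The relation times the product of all denominators.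
  have hG := eq_zero_of_sum_mul_expPoly_eq_zero P hP s (fun j => g j * ∏ k ∈ s.erase j, h k)
    (fun j _ => mul_mem (hg j) (prod_mem fun k _ => hh k)) <| by
      apply hinj
      rw [map_zero, ← mul_zero (algebraMap Entire Mero (∏ k ∈ s, h k)), ← hsum, map_sum,
        Finset.mul_sum]
      refine Finset.sum_congr rfl fun j hj => ?_
      rw [Subfield.smul_def, hc, ← Finset.mul_prod_erase s h hj, smul_eq_mul, map_mul, map_mul,
        map_mul]
      field_simp [hne j]
  intro j hj
  have hgj : g j = 0 :=
    (mul_eq_zero.1 (hG j hj)).resolve_right (Finset.prod_ne_zero_iff.2 fun k _ => h0 k)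
  exact Subtype.ext (by rw [hc, hgj, map_zero, zero_div]; rfl)

/-! ### Algebraic independence. -/

open Polynomial in
/-- A nontrivial integral combination of polynomials of distinct positive degrees is not
constant. -/
theorem natDegree_sum_smul_ne_zero {ι : Type*} {P : ι → ℂ[X]}
    (hd : ∀ j, 1 ≤ (P j).natDegree) (hdd : ∀ j k, j ≠ k → (P j).natDegree ≠ (P k).natDegree)
    (s : Finset ι) (c : ι → ℂ) (hc : ∃ j ∈ s, c j ≠ 0) : (∑ j ∈ s, c j • P j).natDegree ≠ 0 := by
  classical
  -- Degrees are distinct, so the term of largest degree with nonzero coefficient cannot be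
  -- cancelled.
  obtain ⟨m, hm, hmax⟩ := (s.filter (c · ≠ 0)).exists_max_image (fun j => (P j).natDegree)
    (by obtain ⟨j, hj, hj0⟩ := hc; exact ⟨j, Finset.mem_filter.2 ⟨hj, hj0⟩⟩)
  obtain ⟨hms, hm0⟩ := Finset.mem_filter.1 hm
  have hcoeff : (∑ j ∈ s, c j • P j).coeff (P m).natDegree = c m * (P m).leadingCoeff := by
    rw [finsetSum_coeff, Finset.sum_eq_single_of_mem m hms]
    · rw [coeff_smul, smul_eq_mul, coeff_natDegree]
    · intro j hj hjm
      rw [coeff_smul, smul_eq_mul]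
      by_cases hj0 : c j = 0
      · rw [hj0, zero_mul]
      · rw [coeff_eq_zero_of_natDegree_lt, mul_zero]
        exact (hmax j (Finset.mem_filter.2 ⟨hj, hj0⟩)).lt_of_ne (hdd j m hjm)
  have hPm : P m ≠ 0 := fun h => by
    have := hd m
    rw [h, natDegree_zero] at this
    omega
  have := le_natDegree_of_ne_zero (hcoeff ▸ mul_ne_zero hm0 (leadingCoeff_ne_zero.2 hPm))
  have := hd m
  omega

theorem expPoly_sum_smul {ι : Type*} (P : ι → Polynomial ℂ) (n : ι → ℕ) (s : Finset ι) :
    expPoly (∑ j ∈ s, (n j : ℂ) • P j) = ∏ j ∈ s, expPoly (P j) ^ n j := by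
  classical
  have hsmul (k : ℕ) (Q : Polynomial ℂ) : expPoly ((k : ℂ) • Q) = expPoly Q ^ k := by
    induction k with
    | zero => rw [Nat.cast_zero, zero_smul, expPoly_zero, pow_zero]
    | succ k ih => rw [Nat.cast_succ, add_smul, one_smul, expPoly_add, ih, pow_succ]
  induction s using Finset.induction_on with
  | empty => rw [Finset.sum_empty, Finset.prod_empty, expPoly_zero]
  | insert a s ha ih => rw [Finset.sum_insert ha, Finset.prod_insert ha, expPoly_add, ih, hsmul]

theorem algebraicIndependent_expPoly {ι : Type*} [Fintype ι] (P : ι → Polynomial ℂ)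
    (hd : ∀ j, 1 ≤ (P j).natDegree)
    (hdd : ∀ j k, j ≠ k → (P j).natDegree ≠ (P k).natDegree) :
    AlgebraicIndependent (MeroLT 1 one_pos) fun j => algebraMap Entire Mero (expPoly (P j)) := by
  -- The exponent vector `n` indexes the monomial ∏ f_j^{n_j} = exp(∑ n_j P_j).
  have hlin := linearIndependent_expPoly (fun n : ι →₀ ℕ => ∑ j, (n j : ℂ) • P j) <| by
    intro n m hnm
    rw [← Finset.sum_sub_distrib]
    simp only [← sub_smul]
    obtain ⟨j, hj⟩ := DFunLike.ne_iff.1 hnm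
    exact natDegree_sum_smul_ne_zero hd hdd _ _
      ⟨j, Finset.mem_univ j, sub_ne_zero.2 (Nat.cast_injective.ne hj)⟩
  rw [algebraicIndependent_iff]
  intro p hp
  rw [MvPolynomial.aeval_def, MvPolynomial.eval₂_eq'] at hp
  ext n : 1
  rw [MvPolynomial.coeff_zero]
  by_cases hn : n ∈ p.support
  · refine linearIndependent_iff'.1 hlin p.support (fun n => p.coeff n) ?_ n hn
    rw [← hp]
    refine Finset.sum_congr rfl fun n _ => ?_
    rw [Algebra.smul_def, expPoly_sum_smul, map_prod]
    simp only [map_pow]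
  · exact MvPolynomial.notMem_support_iff.1 hn

end MeroOrder

theorem theorem3p3 (r : ℕ) (P : Fin r → Polynomial ℂ)
    (hP : ∀ j k : Fin r, j ≠ k → ¬ ∃ c : ℂ, P j - P k = Polynomial.C c) :
    LinearIndependent (MeroOrder.MeroLT 1 one_pos)
      (fun j : Fin r => algebraMap MeroOrder.Entire MeroOrder.Mero (MeroOrder.expPoly (P j))) ∧
    ((∀ j : Fin r, 1 ≤ (P j).natDegree) →
      (∀ j k : Fin r, j ≠ k → (P j).natDegree ≠ (P k).natDegree) →
      AlgebraicIndependent (MeroOrder.MeroLT 1 one_pos)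
        (fun j : Fin r =>
          algebraMap MeroOrder.Entire MeroOrder.Mero (MeroOrder.expPoly (P j)))) :=
  ⟨MeroOrder.linearIndependent_expPoly P fun j k hjk h0 => hP j k hjk
      ((Polynomial.natDegree_eq_zero.1 h0).imp fun _ hc => hc.symm),
    MeroOrder.algebraicIndependent_expPoly P⟩
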